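/- Setting. Let $n>2$ and let $Ty_n$ be classical extensional higher-order logic (axiomatized as Andrews' $Q_0$ with descriptions) with truth type $t$, individual types $e_1,\dots,e_n$, functional types $(\alpha\beta)$ (functions from $\alpha$ to $\beta$; association to the right) and product types $\alpha\times\beta$ with pairing and projections $\pi_1,\pi_2$. Put $s=e_n$, $c=e_{n-1}$ and $\bar\alpha=c(c\times\alpha)$; objects of type $\bar\alpha$ are identified with pairs of objects of types $cc$ and $c\alpha$ (namely $z_{\bar\alpha}$ with $\lambda x_c\,\pi_1(z\,x_c)$ and $\lambda x_c\,\pi_2(z\,x_c)$), and accordingly $\bar\alpha t$ with $(cc)(c\alpha)t$. Let $\mathcal A=\{a_1,\dots,a_N\}$ be a finite alphabet. $Ty_n^{\mathcal A}$ has constants $C^0_s,C^1_s,\dots,C^N_s$, $C^0_{sss}$ (written $+$), possibly further constants, and the axioms: $x_s+C^0_s=x_s$ and $C^0_s+x_s=x_s$; $(x_s+y_s)+z_s=x_s+(y_s+z_s)$; $x_s+C^i_s+y_s\neq x_s+C^j_s+z_s$ for $1\le i<j\le N$ (universally quantified). $Ty_n^{\mathcal A+}$ is an extension of $Ty_n^{\mathcal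 A}$ by additional non-logical constants. For a word $w\in\mathcal A^*$ the term $T_A(w)$ is given by $T_A(\epsilon)=C^0_s$, $T_A(a_i)=C^i_s$, $T_A(a_iw)=C^i_s+T_A(w)$ for $w\ne\epsilon$. An $\alpha$-language is a set $\mathcal L$ of pairs $(w,A_\alpha)$ of a word $w\in\mathcal A^*$ and a $Ty_n^{\mathcal A}$ term $A_\alpha$ (terms may have free variables). It is represented by $(\Delta,L_{s\alpha t})$, where $\Delta$ is a consistent set of $Ty_n^{\mathcal A+}$ formulas and $L_{s\alpha t}$ a $Ty_n^{\mathcal A+}$ term, if for all words $w$ and $Ty_n^{\mathcal A}$ terms $A_\alpha$ $$(w,A_\alpha)\in\mathcal L\iff\Delta\vdash L_{s\alpha t}\,T_A(w)\,A_\alpha .$$ The representation $(\Delta,L_{s\alpha t})$ is pseudo-canonic if moreover (i) for every word $w$ there is a finite, possibly empty, list of $Ty_n^{\mathcal A}$ terms $A^1_\alpha,\dots,A^l_\alpha$ with $\Delta\vdash L_{s\alpha t}\,T_A(w)=\lambda x_\alpha\,(x_\alpha=A^1_\alpha\vee\dots\vee x_\alpha=A^l_\alpha)$, where $x_\alpha$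 is not free in the $A^i_\alpha$ and the empty disjunction is falsity, and (ii) for every $Ty_n^{\mathcal A}$ formula $A_t$, $\vdash A_t$ in $Ty_n^{\mathcal A}$ iff $\Delta\vdash A_t$ in $Ty_n^{\mathcal A+}$. For an $\alpha$-language $\mathcal L$ and a $Ty_n^{\mathcal A}$ term $F_{\alpha cc}$ the context raising $\mathcal L\uparrow F_{\alpha cc}$ is the $\bar\alpha$-language of all pairs $(w,B_{\bar\alpha})$ for which there is a $Ty_n^{\mathcal A}$ term $A_\alpha$ with $(w,A_\alpha)\in\mathcal L$ and $\vdash CR(F_{\alpha cc})\,A_\alpha\,B_{\bar\alpha}$, where $$CR(F_{\alpha cc})=\lambda x_\alpha\lambda x_{cc}\lambda x_{c\alpha}\,(x_{cc}=F_{\alpha cc}\,x_\alpha\ \wedge\ x_{c\alpha}=\lambda x_c\,x_\alpha)$$ (the variables bound here are pairwise distinct and not free in $F_{\alpha cc}$). Proposition 9.4. If an $\alpha$-language $\mathcal L$ has a pseudo-canonic representation $(\Delta,L_{s\alpha t})$ and $F_{\alpha cc}$ is a $Ty_n^{\mathcal A}$ term, then $\mathcal L\uparrow F_{\alpha cc}$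 has the pseudo-canonic representation $(\Delta,\;L_{s\alpha t}\uparrow F_{\alpha cc})$, where $L_{s\alpha t}\uparrow F_{\alpha cc}$ is the application to $L_{s\alpha t}$ and $F_{\alpha cc}$ of the $Ty_n^{\mathcal A}$ operator $$(\uparrow)=\lambda z_{s\alpha t}\,\lambda z_{\alpha cc}\,\lambda x_s\,\lambda x_{cc}\,\lambda x_{c\alpha}\,\exists x_\alpha\,\bigl(z_{s\alpha t}\,x_s\,x_\alpha\ \wedge\ x_{cc}=z_{\alpha cc}\,x_\alpha\ \wedge\ x_{c\alpha}=\lambda x_c\,x_\alpha\bigr)$$ (with pairwise distinct bound variables). -/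

import Mathlib

universe u v

/-! ## The sorted type theory `Ty_n` with products

Terms are taken up to renaming of bound variables: bound variables are de Bruijn indices, free
variables are named `x^i_α` with `i : ℕ`.  `Tm K Γ α` is the type of terms of type `α` over the
non-logical constants `K` with dangling bound variables of the types listed in `Γ`; the terms of
the theory are those with `Γ = []`. -/

namespace TyN

/-- Types: the truth type `t`, the individual types `e_1, …, e_n`, functional types `(αβ)` and
product types `α × β`. -/
inductive Ty (n : ℕ) : Type
  | t : Ty n
  | e : Fin n → Ty n
  | fn : Ty n → Ty n → Ty n
  | prod : Ty n → Ty n → Ty n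

/-- The functional type from the left type to the right type. -/
infixr:60 " ⇒ₜ " => Ty.fn

/-- The product type. -/
infixr:65 " ×ₜ " => Ty.prod

/-- Positions of type `α` in a list of types. -/
inductive Idx {n : ℕ} : List (Ty n) → Ty n → Type
  | zero {Γ : List (Ty n)} {α : Ty n} : Idx (α :: Γ) α
  | succ {Γ : List (Ty n)} {α β : Ty n} : Idx Γ α → Idx (β :: Γ) α

/-- Terms. `fvar i` at type `α` is the variable `x^i_α`; `const` is a non-logical constant;
`iota` is the description operator of type `(αt)α`. -/
inductive Tm {n : ℕ} (K : Ty n → Type u) : List (Ty n) → Ty n → Type u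
  | bvar {Γ : List (Ty n)} {α : Ty n} : Idx Γ α → Tm K Γ α
  | fvar {Γ : List (Ty n)} {α : Ty n} : ℕ → Tm K Γ α
  | const {Γ : List (Ty n)} {α : Ty n} : K α → Tm K Γ α
  | iota {Γ : List (Ty n)} {α : Ty n} : Tm K Γ ((α ⇒ₜ Ty.t) ⇒ₜ α)
  | app {Γ : List (Ty n)} {α β : Ty n} : Tm K Γ (α ⇒ₜ β) → Tm K Γ α → Tm K Γ β
  | lam {Γ : List (Ty n)} {α β : Ty n} : Tm K (α :: Γ) β → Tm K Γ (α ⇒ₜ β)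
  | eq {Γ : List (Ty n)} {α : Ty n} : Tm K Γ α → Tm K Γ α → Tm K Γ Ty.t
  | pair {Γ : List (Ty n)} {α β : Ty n} : Tm K Γ α → Tm K Γ β → Tm K Γ (α ×ₜ β)
  | fst {Γ : List (Ty n)} {α β : Ty n} : Tm K Γ (α ×ₜ β) → Tm K Γ α
  | snd {Γ : List (Ty n)} {α β : Ty n} : Tm K Γ (α ×ₜ β) → Tm K Γ β

section Terms

variable {n : ℕ} {K : Ty n → Type u} {Γ Θ : List (Ty n)} {α β γ : Ty n}

/-- Extension of a renaming under a binder. -/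
def liftRen (ρ : ∀ α : Ty n, Idx Γ α → Idx Θ α) (β : Ty n) :
    ∀ α : Ty n, Idx (β :: Γ) α → Idx (β :: Θ) α
  | _, Idx.zero => Idx.zero
  | _, Idx.succ i => Idx.succ (ρ _ i)

/-- Renaming of dangling bound variables. -/
def Tm.rename : {Γ Θ : List (Ty n)} → {α : Ty n} →
    (∀ α : Ty n, Idx Γ α → Idx Θ α) → Tm K Γ α → Tm K Θ α
  | _, _, _, ρ, .bvar i => .bvar (ρ _ i)
  | _, _, _, _, .fvar i => .fvar i
  | _, _, _, _, .const k => .const k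
  | _, _, _, _, .iota => .iota
  | _, _, _, ρ, .app A B => .app (A.rename ρ) (B.rename ρ)
  | _, _, _, ρ, .lam A => .lam (A.rename (liftRen ρ _))
  | _, _, _, ρ, .eq A B => .eq (A.rename ρ) (B.rename ρ)
  | _, _, _, ρ, .pair A B => .pair (A.rename ρ) (B.rename ρ)
  | _, _, _, ρ, .fst A => .fst (A.rename ρ)
  | _, _, _, ρ, .snd A => .snd (A.rename ρ)

/-- Weakening: the same term placed under one more binder, which does not bind anything in it. -/
def Tm.wk (A : Tm K Γ α) : Tm K (β :: Γ) α := A.rename (fun _ i => Idx.succ i)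

/-- A term without dangling bound variables placed under any binders. -/
def Tm.wkAll (A : Tm K [] α) : Tm K Γ α := A.rename (fun _ i => by cases i)

/-- Extension of a substitution under a binder. -/
def liftSub (σ : ∀ α : Ty n, Idx Γ α → Tm K Θ α) (β : Ty n) :
    ∀ α : Ty n, Idx (β :: Γ) α → Tm K (β :: Θ) α
  | _, Idx.zero => .bvar Idx.zero
  | _, Idx.succ i => (σ _ i).wk

/-- Capture-avoiding simultaneous substitution for dangling bound variables. -/
def Tm.subst : {Γ Θ : List (Ty n)} → {α : Ty n} →
    (∀ α : Ty n, Idx Γ α → Tm K Θ α) → Tm K Γ α → Tm K Θ α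
  | _, _, _, σ, .bvar i => σ _ i
  | _, _, _, _, .fvar i => .fvar i
  | _, _, _, _, .const k => .const k
  | _, _, _, _, .iota => .iota
  | _, _, _, σ, .app A B => .app (A.subst σ) (B.subst σ)
  | _, _, _, σ, .lam A => .lam (A.subst (liftSub σ _))
  | _, _, _, σ, .eq A B => .eq (A.subst σ) (B.subst σ)
  | _, _, _, σ, .pair A B => .pair (A.subst σ) (B.subst σ)
  | _, _, _, σ, .fst A => .fst (A.subst σ)
  | _, _, _, σ, .snd A => .snd (A.subst σ)

/-- The substitution of `B` for the innermost dangling variable. -/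
def instSub (B : Tm K Γ β) : ∀ α : Ty n, Idx (β :: Γ) α → Tm K Γ α
  | _, Idx.zero => B
  | _, Idx.succ i => .bvar i

/-- `A.inst B`: the body `A` of an abstraction with its bound variable replaced by `B`. -/
def Tm.inst (A : Tm K (β :: Γ) α) (B : Tm K Γ β) : Tm K Γ α := A.subst (instSub B)

/-- Translation of terms along a map of non-logical constants. -/
def Tm.mapConst {K' : Ty n → Type v} (f : ∀ α : Ty n, K α → K' α) :
    {Γ : List (Ty n)} → {α : Ty n} → Tm K Γ α → Tm K' Γ α
  | _, _, .bvar i => .bvar i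
  | _, _, .fvar i => .fvar i
  | _, _, .const k => .const (f _ k)
  | _, _, .iota => .iota
  | _, _, .app A B => .app (A.mapConst f) (B.mapConst f)
  | _, _, .lam A => .lam (A.mapConst f)
  | _, _, .eq A B => .eq (A.mapConst f) (B.mapConst f)
  | _, _, .pair A B => .pair (A.mapConst f) (B.mapConst f)
  | _, _, .fst A => .fst (A.mapConst f)
  | _, _, .snd A => .snd (A.mapConst f)

/-- The innermost bound variable. -/
abbrev b0 : Tm K (α :: Γ) α := .bvar .zero

/-- The second innermost bound variable. -/
abbrev b1 : Tm K (β :: α :: Γ) α := .bvar (.succ .zero)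

/-- The third innermost bound variable. -/
abbrev b2 : Tm K (γ :: β :: α :: Γ) α := .bvar (.succ (.succ .zero))

/-! ### Connectives and quantifiers, defined from equality as in `Q₀` -/

/-- Truth: `(=) = (=)` at type `t`. -/
def tt : Tm K Γ Ty.t :=
  .eq (.lam (.lam (.eq (b1 : Tm K (Ty.t :: Ty.t :: Γ) Ty.t) b0)))
    (.lam (.lam (.eq (b1 : Tm K (Ty.t :: Ty.t :: Γ) Ty.t) b0)))

/-- Falsity: `λ x_t T = λ x_t x_t`. -/
def ff : Tm K Γ Ty.t := .eq (.lam (α := Ty.t) tt) (.lam b0)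

/-- `∀ x_α A`: `λ x_α T = λ x_α A`. -/
def all (A : Tm K (α :: Γ) Ty.t) : Tm K Γ Ty.t := .eq (.lam tt) (.lam A)

/-- Conjunction as a term: `λ x_t λ y_t (λ g (g T T) = λ g (g x y))`. -/
def andC : Tm K Γ (Ty.t ⇒ₜ Ty.t ⇒ₜ Ty.t) :=
  .lam (.lam (.eq
    (.lam (.app (.app (b0 : Tm K _ (Ty.t ⇒ₜ Ty.t ⇒ₜ Ty.t)) tt) tt))
    (.lam (.app (.app (b0 : Tm K _ (Ty.t ⇒ₜ Ty.t ⇒ₜ Ty.t)) b2) b1))))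

/-- Conjunction. -/
def and (A B : Tm K Γ Ty.t) : Tm K Γ Ty.t := .app (.app andC A) B

/-- Implication as a term: `λ x_t λ y_t (x = (x ∧ y))`. -/
def impC : Tm K Γ (Ty.t ⇒ₜ Ty.t ⇒ₜ Ty.t) := .lam (.lam (.eq b1 (and b1 b0)))

/-- Implication. -/
def imp (A B : Tm K Γ Ty.t) : Tm K Γ Ty.t := .app (.app impC A) B

/-- Negation: `F = A`. -/
def not (A : Tm K Γ Ty.t) : Tm K Γ Ty.t := .eq ff A

/-- Disjunction as a term: `λ x_t λ y_t ¬ (¬ x ∧ ¬ y)`. -/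
def orC : Tm K Γ (Ty.t ⇒ₜ Ty.t ⇒ₜ Ty.t) := .lam (.lam (not (and (not b1) (not b0))))

/-- Disjunction. -/
def or (A B : Tm K Γ Ty.t) : Tm K Γ Ty.t := .app (.app orC A) B

/-- `∃ x_α A`: `¬ ∀ x_α ¬ A`. -/
def ex (A : Tm K (α :: Γ) Ty.t) : Tm K Γ Ty.t := not (all (not A))

/-- The section `(= B)`: `λ x_α (x_α = B)`. -/
def eqTo (B : Tm K Γ α) : Tm K Γ (α ⇒ₜ Ty.t) := .lam (.eq b0 B.wk)

/-- Disjunction of predicates: `λ x_α (A x_α ∨ B x_α)`. -/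
def orPred (A B : Tm K Γ (α ⇒ₜ Ty.t)) : Tm K Γ (α ⇒ₜ Ty.t) :=
  .lam (or (.app A.wk b0) (.app B.wk b0))

/-- Product of predicates: `λ x_α λ x_β (A x_α ∧ B x_β)`. -/
def prodPred (A : Tm K Γ (α ⇒ₜ Ty.t)) (B : Tm K Γ (β ⇒ₜ Ty.t)) :
    Tm K Γ (α ⇒ₜ β ⇒ₜ Ty.t) :=
  .lam (.lam (and (.app A.wk.wk b1) (.app B.wk.wk b0)))

/-- The predicate `(= A¹) ∨ … ∨ (= Aˡ)`, which is `λ x_α F` for the empty list. -/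
def bigOrEq : List (Tm K Γ α) → Tm K Γ (α ⇒ₜ Ty.t)
  | [] => .lam ff
  | A :: l => orPred (eqTo A) (bigOrEq l)

end Terms

/-! ### Provability -/

/-- The theorems of the theory with non-logical axioms `Ax` (formulas without dangling
variables), in the axiomatization `Q₀` with descriptions, generalized to many sorts and to
products. The theorems with dangling variables `Γ` are derived simultaneously, so that a rule can
be applied under binders; rule R (replacement of equals by equals at any place of a theorem)
is given by `eqMP` together with the congruence rules. -/
inductive Thm {n : ℕ} {K : Ty n → Type u} (Ax : Set (Tm K [] Ty.t)) :
    {Γ : List (Ty n)} → Tm K Γ Ty.t → Prop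
  /-- a non-logical axiom -/
  | ax {Γ : List (Ty n)} {A : Tm K [] Ty.t} : A ∈ Ax → Thm Ax (A.wkAll : Tm K Γ Ty.t)
  /-- `(g T ∧ g F) = ∀ x_t (g x)` -/
  | bool {Γ : List (Ty n)} (g : Tm K Γ (Ty.t ⇒ₜ Ty.t)) :
      Thm Ax (.eq (and (.app g tt) (.app g ff)) (all (.app g.wk b0)))
  /-- `A = B → (h A = h B)` -/
  | leibniz {Γ : List (Ty n)} {α : Ty n} (A B : Tm K Γ α) (h : Tm K Γ (α ⇒ₜ Ty.t)) :
      Thm Ax (imp (.eq A B) (.eq (.app h A) (.app h B)))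
  /-- `(f = g) = ∀ x_α (f x = g x)` -/
  | funext {Γ : List (Ty n)} {α β : Ty n} (f g : Tm K Γ (α ⇒ₜ β)) :
      Thm Ax (.eq (.eq f g) (all (.eq (.app f.wk b0) (.app g.wk b0))))
  /-- `(λ x A) B = A(B)` -/
  | beta {Γ : List (Ty n)} {α β : Ty n} (A : Tm K (α :: Γ) β) (B : Tm K Γ α) :
      Thm Ax (.eq (.app (.lam A) B) (A.inst B))
  /-- `ι (λ x (A = x)) = A` -/
  | descr {Γ : List (Ty n)} {α : Ty n} (A : Tm K Γ α) :
      Thm Ax (.eq (.app .iota (.lam (.eq A.wk b0))) A)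
  /-- `π₁ (A, B) = A` -/
  | fst_pair {Γ : List (Ty n)} {α β : Ty n} (A : Tm K Γ α) (B : Tm K Γ β) :
      Thm Ax (.eq (.fst (.pair A B)) A)
  /-- `π₂ (A, B) = B` -/
  | snd_pair {Γ : List (Ty n)} {α β : Ty n} (A : Tm K Γ α) (B : Tm K Γ β) :
      Thm Ax (.eq (.snd (.pair A B)) B)
  /-- `(π₁ A, π₂ A) = A` -/
  | pair_eta {Γ : List (Ty n)} {α β : Ty n} (A : Tm K Γ (α ×ₜ β)) :
      Thm Ax (.eq (.pair (.fst A) (.snd A)) A)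
  | eqMP {Γ : List (Ty n)} {A B : Tm K Γ Ty.t} : Thm Ax (.eq A B) → Thm Ax A → Thm Ax B
  | refl {Γ : List (Ty n)} {α : Ty n} (A : Tm K Γ α) : Thm Ax (.eq A A)
  | congApp {Γ : List (Ty n)} {α β : Ty n} {A A' : Tm K Γ (α ⇒ₜ β)} {B B' : Tm K Γ α} :
      Thm Ax (.eq A A') → Thm Ax (.eq B B') → Thm Ax (.eq (.app A B) (.app A' B'))
  | congLam {Γ : List (Ty n)} {α β : Ty n} {A A' : Tm K (α :: Γ) β} :
      Thm Ax (.eq A A') → Thm Ax (.eq (.lam A) (.lam A'))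
  | congEq {Γ : List (Ty n)} {α : Ty n} {A A' B B' : Tm K Γ α} :
      Thm Ax (.eq A A') → Thm Ax (.eq B B') → Thm Ax (.eq (.eq A B) (.eq A' B'))
  | congPair {Γ : List (Ty n)} {α β : Ty n} {A A' : Tm K Γ α} {B B' : Tm K Γ β} :
      Thm Ax (.eq A A') → Thm Ax (.eq B B') → Thm Ax (.eq (.pair A B) (.pair A' B'))
  | congFst {Γ : List (Ty n)} {α β : Ty n} {A A' : Tm K Γ (α ×ₜ β)} :
      Thm Ax (.eq A A') → Thm Ax (.eq (.fst A) (.fst A'))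
  | congSnd {Γ : List (Ty n)} {α β : Ty n} {A A' : Tm K Γ (α ×ₜ β)} :
      Thm Ax (.eq A A') → Thm Ax (.eq (.snd A) (.snd A'))

/-- `Δ ⊢ A` in the theory with non-logical axioms `Ax`: derivability from theorems and from the
hypotheses `Δ` by modus ponens. The free variables of the hypotheses are held fixed, so that the
Deduction Theorem holds. -/
inductive Derives {n : ℕ} {K : Ty n → Type u} (Ax Δ : Set (Tm K [] Ty.t)) : Tm K [] Ty.t → Prop
  | hyp {A : Tm K [] Ty.t} : A ∈ Δ → Derives Ax Δ A
  | thm {A : Tm K [] Ty.t} : Thm Ax A → Derives Ax Δ A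
  | mp {A B : Tm K [] Ty.t} : Derives Ax Δ (imp A B) → Derives Ax Δ A → Derives Ax Δ B

/-! ## The extension `Ty_n^𝒜` by a symbolic type, with a context type -/

section Symbolic

variable {n : ℕ} [hn : Fact (2 < n)]

/-- The symbolic type `s = e_n`. -/
def sTy : Ty n := .e ⟨n - 1, by have := hn.out; omega⟩

/-- The context type `c = e_{n-1}`. -/
def cTy : Ty n := .e ⟨n - 2, by have := hn.out; omega⟩

/-- The type `c(c × α)` of the meanings of a context-dependent `α`-language. -/
abbrev ctxTy (α : Ty n) : Ty n := cTy ⇒ₜ (cTy ×ₜ α)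

/-- The non-logical constants of `Ty_n^𝒜` for the alphabet `a_1, …, a_N`: the empty word `C⁰_s`,
the letters `C¹_s, …, Cᴺ_s`, the concatenation `C⁰_{sss}`, and arbitrary other constants `S`. -/
inductive SymConst (N : ℕ) (S : Ty n → Type u) : Ty n → Type u
  | eps : SymConst N S sTy
  | letter : Fin N → SymConst N S sTy
  | concat : SymConst N S (sTy ⇒ₜ sTy ⇒ₜ sTy)
  | other {α : Ty n} : S α → SymConst N S α

/-- The terms of `Ty_n^𝒜`. -/
abbrev STm (N : ℕ) (S : Ty n → Type u) (α : Ty n) : Type u := Tm (SymConst N S) [] α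

variable {N : ℕ} {S : Ty n → Type u} {Γ : List (Ty n)} {α β : Ty n}

/-- `C⁰_s`. -/
def epsT : Tm (SymConst N S) Γ sTy := .const .eps

/-- `Cⁱ_s`. -/
def letT (i : Fin N) : Tm (SymConst N S) Γ sTy := .const (.letter i)

/-- `A + B`. -/
def cat (A B : Tm (SymConst N S) Γ sTy) : Tm (SymConst N S) Γ sTy :=
  .app (.app (.const .concat) A) B

variable (N S) in
/-- The non-logical axioms of `Ty_n^𝒜`: `C⁰_s` is neutral, concatenation is associative, and
`x + Cⁱ + y ≠ x + Cʲ + z` for `i < j`. -/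
inductive SymAx : Tm (SymConst N S) [] Ty.t → Prop
  | unit : SymAx (all (and (.eq (cat b0 epsT) b0) (.eq (cat epsT b0) b0)))
  | assoc : SymAx (all (all (all (.eq (cat (cat b2 b1) b0) (cat b2 (cat b1 b0))))))
  | sep (i j : Fin N) : i < j →
      SymAx (all (all (all (not
        (.eq (cat (cat b2 (letT i)) b1) (cat (cat b2 (letT j)) b0))))))

/-- `⊢ A` in `Ty_n^𝒜`. -/
def SProv (A : STm N S Ty.t) : Prop := Thm {B | SymAx N S B} A

/-- `Δ ⊢ A` in `Ty_n^𝒜`. -/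
def SDerives (Δ : Set (STm N S Ty.t)) (A : STm N S Ty.t) : Prop := Derives {B | SymAx N S B} Δ A

/-- The term `T_A(w)` denoting the word `w`. -/
def wordT : List (Fin N) → STm N S sTy
  | [] => epsT
  | [i] => letT i
  | i :: j :: w => cat (letT i) (wordT (j :: w))

/-- Inclusion of the constants of `Ty_n^𝒜` in those of its extension by the constants `E`. -/
def inclConst (E : Ty n → Type v) :
    ∀ α : Ty n, SymConst N S α → SymConst N (fun α => S α ⊕ E α) α
  | _, .eps => .eps
  | _, .letter i => .letter i
  | _, .concat => .concat
  | _, .other k => .other (.inl k)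

/-- A term of `Ty_n^𝒜` as a term of its extension by the constants `E`. -/
def incl (E : Ty n → Type v) (A : STm N S α) : STm N (fun α => S α ⊕ E α) α :=
  A.mapConst (inclConst E)

/-! ### Languages and rules -/

/-- `α`-languages: relations between words and `α`-terms. -/
abbrev ALang (N : ℕ) (S : Ty n → Type u) (α : Ty n) : Type u := Set (List (Fin N) × STm N S α)

/-- Semantic rules: relations between `α`-terms and `β`-terms. -/
abbrev SemRule (N : ℕ) (S : Ty n → Type u) (α β : Ty n) : Type u :=
  Set (STm N S α × STm N S β)

/-- Application of a semantic rule to a language. -/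
def applyRule (L : ALang N S α) (R : SemRule N S α β) : ALang N S β :=
  {p | ∃ A : STm N S α, (p.1, A) ∈ L ∧ (A, p.2) ∈ R}

/-- The semantic rule represented by a term `R` of type `αβt`. -/
def ruleOf (R : STm N S (α ⇒ₜ β ⇒ₜ Ty.t)) : SemRule N S α β :=
  {p | SProv (.app (.app R p.1) p.2)}

/-- The identification of `(cc)(cα)t` with `c(c × α)t`: a relation between `cc`- and `cα`-objects
as the predicate `λ z (R (λ x_c π₁ (z x_c)) (λ x_c π₂ (z x_c)))` on `c(c × α)`-objects. -/
def uncur (R : Tm (SymConst N S) Γ ((cTy ⇒ₜ cTy) ⇒ₜ (cTy ⇒ₜ α) ⇒ₜ Ty.t)) :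
    Tm (SymConst N S) Γ (ctxTy α ⇒ₜ Ty.t) :=
  .lam (.app (.app R.wk (.lam (.fst (.app b1 b0)))) (.lam (.snd (.app b1 b0))))

/-- The context raising term `λ x_α ((= F x_α) × (= λ x_c x_α))`. -/
def raiseRuleT (F : STm N S (α ⇒ₜ cTy ⇒ₜ cTy)) : STm N S (α ⇒ₜ ctxTy α ⇒ₜ Ty.t) :=
  .lam (uncur (prodPred (eqTo (.app F.wk b0)) (eqTo (.lam b1))))

/-- Context raising `ℒ ↑ F` of an `α`-language. -/
def raise (L : ALang N S α) (F : STm N S (α ⇒ₜ cTy ⇒ₜ cTy)) : ALang N S (ctxTy α) :=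
  applyRule L (ruleOf (raiseRuleT F))

/-- The operator `↑`:
`λ z_{sαt} λ z_{αcc} λ x_s λ x_{cc} λ x_{cα} ∃ x_α
(z_{sαt} x_s x_α ∧ x_{cc} = z_{αcc} x_α ∧ x_{cα} = λ x_c x_α)`. -/
def upT : Tm (SymConst N S) Γ
    ((sTy ⇒ₜ α ⇒ₜ Ty.t) ⇒ₜ (α ⇒ₜ cTy ⇒ₜ cTy) ⇒ₜ sTy ⇒ₜ ctxTy α ⇒ₜ Ty.t) :=
  .lam (.lam (.lam (uncur (.lam (.lam (ex
    (and (.app (.app (.bvar (.succ (.succ (.succ (.succ (.succ .zero)))))) (.bvar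
        (.succ (.succ (.succ .zero))))) b0)
      (and (.eq b2 (.app (.bvar (.succ (.succ (.succ (.succ .zero))))) b0))
        (.eq b1 (.lam b1))))))))))

/-! ### Representations -/

/-- The `α`-language `ℒ` is represented by `(Δ, L)`, where `Δ` is a consistent set of formulas and
`L` a term of the extension of `Ty_n^𝒜` by the constants `E`. -/
structure Represents (E : Ty n → Type v) (Δ : Set (STm N (fun α => S α ⊕ E α) Ty.t))
    (L : STm N (fun α => S α ⊕ E α) (sTy ⇒ₜ α ⇒ₜ Ty.t)) (ℒ : ALang N S α) : Prop where
  consistent : ¬ SDerives Δ ff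
  mem_iff : ∀ (w : List (Fin N)) (A : STm N S α),
    (w, A) ∈ ℒ ↔ SDerives Δ (.app (.app L (wordT w)) (incl E A))

/-- `(Δ, L)` is a pseudo-canonic representation of the `α`-language `ℒ`. -/
structure PseudoCanonic (E : Ty n → Type v) (Δ : Set (STm N (fun α => S α ⊕ E α) Ty.t))
    (L : STm N (fun α => S α ⊕ E α) (sTy ⇒ₜ α ⇒ₜ Ty.t)) (ℒ : ALang N S α) : Prop
    extends Represents E Δ L ℒ where
  finite_meanings : ∀ w : List (Fin N), ∃ l : List (STm N S α),
    SDerives Δ (.eq (.app L (wordT w)) (bigOrEq (l.map (incl E))))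
  conservative : ∀ A : STm N S Ty.t, SProv A ↔ SDerives Δ (incl E A)

end Symbolic

end TyN

/-!
The objects `F A` and `λ x_c A` are the two components of the single object
`⟨F⟩ A = λ x_c (F A x_c, A)`. Hence `ℒ ↑ F` consists of the pairs `(w, B)` with `⊢ B = ⟨F⟩ A` for
some `(w, A) ∈ ℒ`, and `(L ↑ F) T(w)` is provably the image of the predicate `L T(w)` under `⟨F⟩`.
Taking images commutes with finite disjunctions of the predicates `(= A)`, so meanings stay
finitely many. Moreover `⟨F⟩` has the left inverse `λ z π₂ (z x_c)` with `x_c` a free variable: if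
`Δ` proves that `B` lies in the image, then it proves `B = ⟨F⟩ A` and `L T(w) A` for the explicit
term `A = π₂ (B x_c)`, so no witness property of `Δ` is needed.
-/

namespace TyN

/-! ### Renaming and substitution -/

section Substitution

variable {n : ℕ} {K : Ty n → Type u} {Γ Θ Ξ : List (Ty n)} {α β γ : Ty n}

@[simp] theorem liftRen_zero (ρ : ∀ α : Ty n, Idx Γ α → Idx Θ α) :
    liftRen ρ β β .zero = .zero := rfl

@[simp] theorem liftRen_succ (ρ : ∀ α : Ty n, Idx Γ α → Idx Θ α) (i : Idx Γ α) :
    liftRen ρ β α (.succ i) = .succ (ρ α i) := rfl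

@[simp] theorem liftSub_zero (σ : ∀ α : Ty n, Idx Γ α → Tm K Θ α) :
    liftSub σ β β .zero = .bvar .zero := rfl

@[simp] theorem liftSub_succ (σ : ∀ α : Ty n, Idx Γ α → Tm K Θ α) (i : Idx Γ α) :
    liftSub σ β α (.succ i) = (σ α i).wk := rfl

@[simp] theorem instSub_zero (B : Tm K Γ β) : instSub B β .zero = B := rfl

@[simp] theorem instSub_succ (B : Tm K Γ β) (i : Idx Γ α) :
    instSub B α (.succ i) = .bvar i := rfl

theorem liftSub_bvar :
    liftSub (fun α (i : Idx Γ α) => (.bvar i : Tm K Γ α)) β = fun _ i => .bvar i := by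
  funext α i
  cases i <;> rfl

namespace Tm

attribute [simp] Tm.rename Tm.subst Tm.inst

theorem rename_rename (A : Tm K Γ α) (ρ : ∀ α, Idx Γ α → Idx Θ α) (ρ' : ∀ α, Idx Θ α → Idx Ξ α) :
    (A.rename ρ).rename ρ' = A.rename fun α i => ρ' α (ρ α i) := by
  induction A generalizing Θ Ξ with
  | lam A ih =>
    simp only [rename, ih]
    congr 2
    funext α i
    cases i <;> rfl
  | _ => simp_all only [rename]

theorem subst_of_rename (A : Tm K Γ α) (ρ : ∀ α, Idx Γ α → Idx Θ α)
    (σ : ∀ α, Idx Θ α → Tm K Ξ α) :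
    (A.rename ρ).subst σ = A.subst fun α i => σ α (ρ α i) := by
  induction A generalizing Θ Ξ with
  | lam A ih =>
    simp only [rename, subst, ih]
    congr 2
    funext α i
    cases i <;> rfl
  | _ => simp_all only [rename, subst]

@[simp] theorem rename_succ (A : Tm K Γ α) :
    A.rename (fun _ i => .succ i) = A.wk (β := β) := rfl

@[simp] theorem rename_liftRen_wk (A : Tm K Γ α) (ρ : ∀ α, Idx Γ α → Idx Θ α) :
    (A.wk (β := β)).rename (liftRen ρ β) = (A.rename ρ).wk := by
  simp only [wk, rename_rename, liftRen_succ]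

theorem rename_of_subst (A : Tm K Γ α) (σ : ∀ α, Idx Γ α → Tm K Θ α)
    (ρ : ∀ α, Idx Θ α → Idx Ξ α) :
    (A.subst σ).rename ρ = A.subst fun α i => (σ α i).rename ρ := by
  induction A generalizing Θ Ξ with
  | lam A ih =>
    simp only [rename, subst, ih]
    congr 2
    funext α i
    cases i with
    | zero => rfl
    | succ i => exact rename_liftRen_wk _ _
  | _ => simp_all only [rename, subst]

theorem subst_bvar (A : Tm K Γ α) : A.subst (fun _ i => .bvar i) = A := by
  induction A with
  | lam A ih => simp only [subst, liftSub_bvar, ih]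
  | _ => simp_all only [subst]

@[simp] theorem subst_liftSub_wk (A : Tm K Γ α) (σ : ∀ α, Idx Γ α → Tm K Θ α) :
    (A.wk (β := β)).subst (liftSub σ β) = (A.subst σ).wk := by
  simp only [wk, subst_of_rename, rename_of_subst, liftSub_succ]

@[simp] theorem subst_instSub_wk (A : Tm K Γ α) (B : Tm K Γ β) : A.wk.subst (instSub B) = A := by
  simp only [wk, subst_of_rename, instSub_succ, subst_bvar]

/-- Weakening below the innermost binder: the body of an abstraction placed under one more binder
together with it. -/
abbrev wkUnder (A : Tm K (β :: Γ) α) : Tm K (β :: γ :: Γ) α :=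
  A.rename (liftRen (fun _ i => .succ i) β)

@[simp] theorem wkUnder_subst_instSub_b0 (A : Tm K (β :: Γ) α) :
    A.wkUnder.subst (instSub b0) = A := by
  rw [subst_of_rename]
  convert A.subst_bvar using 2
  funext α i
  cases i <;> rfl

@[simp] theorem wkUnder_subst_liftSub_instSub (A : Tm K (β :: Γ) α) (B : Tm K Γ γ) :
    A.wkUnder.subst (liftSub (instSub B) β) = A := by
  rw [subst_of_rename]
  convert A.subst_bvar using 2
  funext α i
  cases i <;> rfl

theorem wk_inst (A : Tm K (β :: Γ) α) (B : Tm K Γ β) :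
    (A.inst B).wk (β := γ) = A.wkUnder.inst B.wk := by
  simp only [inst, wk, rename_of_subst, subst_of_rename]
  congr 1
  funext α i
  cases i <;> rfl

@[simp] theorem wk_bvar (i : Idx Γ α) :
    (bvar i : Tm K Γ α).wk (β := β) = .bvar (.succ i) := rfl

@[simp] theorem wk_app (A : Tm K Γ (α ⇒ₜ γ)) (B : Tm K Γ α) :
    (app A B).wk (β := β) = .app A.wk B.wk := rfl

@[simp] theorem wk_lam (A : Tm K (α :: Γ) γ) : (lam A).wk (β := β) = .lam A.wkUnder := rfl

section MapConst

variable {K' : Ty n → Type v} (f : ∀ α, K α → K' α)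

theorem mapConst_rename (A : Tm K Γ α) (ρ : ∀ α, Idx Γ α → Idx Θ α) :
    (A.rename ρ).mapConst f = (A.mapConst f).rename ρ := by
  induction A generalizing Θ <;> simp_all only [mapConst, rename]

theorem mapConst_wk (A : Tm K Γ α) : (A.wk (β := β)).mapConst f = (A.mapConst f).wk :=
  A.mapConst_rename f _

end MapConst

end Tm

section Connectives

variable (σ : ∀ α, Idx Γ α → Tm K Θ α) (ρ : ∀ α, Idx Γ α → Idx Θ α)

@[simp] theorem tt_subst : (tt : Tm K Γ Ty.t).subst σ = tt := rfl

@[simp] theorem tt_wk : (tt : Tm K Γ Ty.t).wk (β := β) = tt := rfl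

@[simp] theorem ff_subst : (ff : Tm K Γ Ty.t).subst σ = ff := rfl

@[simp] theorem ff_wk : (ff : Tm K Γ Ty.t).wk (β := β) = ff := rfl

variable (A B : Tm K Γ Ty.t)

@[simp] theorem and_subst : (and A B).subst σ = and (A.subst σ) (B.subst σ) := rfl

@[simp] theorem and_rename : (and A B).rename ρ = and (A.rename ρ) (B.rename ρ) := rfl

@[simp] theorem imp_subst : (imp A B).subst σ = imp (A.subst σ) (B.subst σ) := rfl

@[simp] theorem or_subst : (or A B).subst σ = or (A.subst σ) (B.subst σ) := rfl

@[simp] theorem or_rename : (or A B).rename ρ = or (A.rename ρ) (B.rename ρ) := rfl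

@[simp] theorem not_subst : (not A).subst σ = not (A.subst σ) := rfl

@[simp] theorem all_subst (P : Tm K (β :: Γ) Ty.t) :
    (all P).subst σ = all (P.subst (liftSub σ β)) := rfl

@[simp] theorem ex_subst (P : Tm K (β :: Γ) Ty.t) :
    (ex P).subst σ = ex (P.subst (liftSub σ β)) := rfl

@[simp] theorem ex_rename (P : Tm K (β :: Γ) Ty.t) :
    (ex P).rename ρ = ex (P.rename (liftRen ρ β)) := rfl

end Connectives

@[simp] theorem eqTo_subst (σ : ∀ α, Idx Γ α → Tm K Θ α) (B : Tm K Γ α) :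
    (eqTo B).subst σ = eqTo (B.subst σ) := by
  simp [eqTo]

@[simp] theorem eqTo_wk (B : Tm K Γ α) : (eqTo B).wk (β := β) = eqTo B.wk := by
  simp [eqTo]

@[simp] theorem orPred_subst (σ : ∀ α, Idx Γ α → Tm K Θ α) (P Q : Tm K Γ (α ⇒ₜ Ty.t)) :
    (orPred P Q).subst σ = orPred (P.subst σ) (Q.subst σ) := by
  simp [orPred]

@[simp] theorem orPred_wk (P Q : Tm K Γ (α ⇒ₜ Ty.t)) :
    (orPred P Q).wk (β := β) = orPred P.wk Q.wk := by
  simp [orPred]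

@[simp] theorem prodPred_subst (σ : ∀ α, Idx Γ α → Tm K Θ α) (P : Tm K Γ (α ⇒ₜ Ty.t))
    (Q : Tm K Γ (β ⇒ₜ Ty.t)) : (prodPred P Q).subst σ = prodPred (P.subst σ) (Q.subst σ) := by
  simp [prodPred]

end Substitution

/-! ### Equational reasoning and the truth tables -/

section Logic

variable {n : ℕ} {K : Ty n → Type u} {Ax : Set (Tm K [] Ty.t)} {Γ Θ : List (Ty n)}
  {α β γ δ : Ty n}

/-- Provable equality of terms, as a relation to compute with. -/
abbrev ProvEq (Ax : Set (Tm K [] Ty.t)) (A B : Tm K Γ α) : Prop := Thm Ax (.eq A B)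

notation:50 A:51 " ≐[" Ax "] " B:51 => ProvEq Ax A B

namespace Thm

theorem symm {A B : Tm K Γ α} (h : A ≐[Ax] B) : B ≐[Ax] A :=
  eqMP (congEq h (refl A)) (refl A)

theorem trans {A B C : Tm K Γ α} (h : A ≐[Ax] B) (h' : B ≐[Ax] C) : A ≐[Ax] C :=
  eqMP (congEq (refl A) h') h

instance : Trans (ProvEq Ax : Tm K Γ α → Tm K Γ α → Prop) (ProvEq Ax) (ProvEq Ax) := ⟨trans⟩

theorem eqMPR {A B : Tm K Γ Ty.t} (h : A ≐[Ax] B) (hB : Thm Ax B) : Thm Ax A :=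
  eqMP h.symm hB

theorem beta_of {P : Tm K (α :: Γ) β} {A : Tm K Γ α} {B : Tm K Γ β} (h : P.inst A = B) :
    .app (.lam P) A ≐[Ax] B :=
  h ▸ beta P A

theorem beta₂_of {P : Tm K (β :: α :: Γ) γ} {A : Tm K Γ α} {B : Tm K Γ β} {C : Tm K Γ γ}
    (h : (P.subst (liftSub (instSub A) β)).inst B = C) :
    .app (.app (.lam (.lam P)) A) B ≐[Ax] C :=
  (congApp (beta _ A) (refl B)).trans (beta_of h)

theorem inst_congr (M : Tm K (α :: Γ) β) {A B : Tm K Γ α} (h : A ≐[Ax] B) :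
    M.inst A ≐[Ax] M.inst B :=
  (beta M A).symm.trans ((congApp (refl _) h).trans (beta M B))

theorem all_congr {P Q : Tm K (α :: Γ) Ty.t} (h : P ≐[Ax] Q) : all P ≐[Ax] all Q :=
  congEq (refl _) (congLam h)

theorem not_congr {A B : Tm K Γ Ty.t} (h : A ≐[Ax] B) : not A ≐[Ax] not B :=
  congEq (refl _) h

theorem ex_congr {P Q : Tm K (α :: Γ) Ty.t} (h : P ≐[Ax] Q) : ex P ≐[Ax] ex Q :=
  not_congr (all_congr (not_congr h))

section Congruence

variable {A A' B B' : Tm K Γ Ty.t}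

theorem and_congr (h : A ≐[Ax] A') (h' : B ≐[Ax] B') : and A B ≐[Ax] and A' B' :=
  congApp (congApp (refl _) h) h'

theorem imp_congr (h : A ≐[Ax] A') (h' : B ≐[Ax] B') : imp A B ≐[Ax] imp A' B' :=
  congApp (congApp (refl _) h) h'

theorem or_congr (h : A ≐[Ax] A') (h' : B ≐[Ax] B') : or A B ≐[Ax] or A' B' :=
  congApp (congApp (refl _) h) h'

end Congruence

theorem tt_intro : Thm Ax (tt : Tm K Γ Ty.t) := refl _

theorem tt_eq_inst {P : Tm K (α :: Γ) Ty.t} (h : Thm Ax (all P)) (A : Tm K Γ α) :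
    tt ≐[Ax] P.inst A :=
  calc tt
    _ ≐[Ax] .app (.lam tt) A := (beta tt A).symm
    _ ≐[Ax] .app (.lam P) A := congApp h (refl A)
    _ ≐[Ax] P.inst A := beta P A

theorem all_elim {P : Tm K (α :: Γ) Ty.t} (h : Thm Ax (all P)) (A : Tm K Γ α) :
    Thm Ax (P.inst A) :=
  eqMP (tt_eq_inst h A) tt_intro

/-- Extensionality turns `(λ x x) = (λ x x)` into a universally quantified formula, which is the
only source of an equation with `tt` before `tt_eq` is available. -/
theorem tt_eq_refl (A : Tm K Γ α) : tt ≐[Ax] .eq A A :=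
  have id_eq_id := eqMP (funext (Ax := Ax) (.lam b0 : Tm K Γ (α ⇒ₜ α)) (.lam b0)) (refl _)
  (tt_eq_inst id_eq_id A).trans (congEq (beta b0 A) (beta b0 A))

theorem tt_eq_of_eq {A B : Tm K Γ α} (h : A ≐[Ax] B) : tt ≐[Ax] .eq A B :=
  (tt_eq_refl A).trans (congEq (refl A) h)

theorem and_inst_tt_ff (P : Tm K (Ty.t :: Γ) Ty.t) :
    and (P.inst tt) (P.inst ff) ≐[Ax] all P :=
  calc and (P.inst tt) (P.inst ff)
    _ ≐[Ax] and (.app (.lam P) tt) (.app (.lam P) ff) :=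
      and_congr (beta P tt).symm (beta P ff).symm
    _ ≐[Ax] all (.app (Tm.lam P).wk b0) := bool (.lam P)
    _ ≐[Ax] all P := all_congr (beta_of (by simp))

theorem and_tt_tt : and tt tt ≐[Ax] (tt : Tm K Γ Ty.t) :=
  (and_inst_tt_ff tt).trans (tt_eq_refl _).symm

theorem and_tt_ff : and tt ff ≐[Ax] (ff : Tm K Γ Ty.t) := and_inst_tt_ff b0

theorem eq_cases {M N : Tm K (Ty.t :: Γ) β} (htt : M.inst tt ≐[Ax] N.inst tt)
    (hff : M.inst ff ≐[Ax] N.inst ff) (A : Tm K Γ Ty.t) : M.inst A ≐[Ax] N.inst A :=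
  have conj := eqMP (and_congr (tt_eq_of_eq htt) (tt_eq_of_eq hff)) (eqMPR and_tt_tt tt_intro)
  all_elim (eqMP (and_inst_tt_ff (.eq M N)) conj) A

theorem tt_and (A : Tm K Γ Ty.t) : and tt A ≐[Ax] A :=
  eq_cases (M := and tt b0) (N := b0) and_tt_tt and_tt_ff A

theorem tt_eq_ff : .eq tt ff ≐[Ax] (ff : Tm K Γ Ty.t) :=
  have ff_eq_all : ff ≐[Ax] all (.eq tt (b0 : Tm K (Ty.t :: Γ) Ty.t)) :=
    (funext (.lam tt) (.lam b0)).trans (all_congr (congEq (beta tt b0) (beta b0 b0)))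
  calc .eq tt ff
    _ ≐[Ax] and tt (.eq tt ff) := (tt_and _).symm
    _ ≐[Ax] and (.eq tt tt) (.eq tt ff) := and_congr (tt_eq_refl tt) (refl _)
    _ ≐[Ax] all (.eq tt b0) := and_inst_tt_ff (.eq tt b0)
    _ ≐[Ax] ff := ff_eq_all.symm

theorem tt_eq (A : Tm K Γ Ty.t) : .eq tt A ≐[Ax] A :=
  eq_cases (M := .eq tt b0) (N := b0) (tt_eq_refl tt).symm tt_eq_ff A

theorem eq_tt {A : Tm K Γ Ty.t} (h : Thm Ax A) : A ≐[Ax] tt := (eqMPR (tt_eq A) h).symm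

theorem and_intro {A B : Tm K Γ Ty.t} (h : Thm Ax A) (h' : Thm Ax B) : Thm Ax (and A B) :=
  eqMPR ((and_congr (eq_tt h) (eq_tt h')).trans and_tt_tt) tt_intro

theorem bool_cases {P : Tm K (Ty.t :: Γ) Ty.t} (htt : Thm Ax (P.inst tt))
    (hff : Thm Ax (P.inst ff)) (A : Tm K Γ Ty.t) : Thm Ax (P.inst A) :=
  all_elim (eqMP (and_inst_tt_ff P) (and_intro htt hff)) A

theorem all_intro {P : Tm K (α :: Γ) Ty.t} (h : Thm Ax P) : Thm Ax (all P) :=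
  congLam (eq_tt h).symm

theorem imp_def (A B : Tm K Γ Ty.t) : imp A B ≐[Ax] .eq A (and A B) := beta₂_of (by simp)

theorem or_def (A B : Tm K Γ Ty.t) : or A B ≐[Ax] not (and (not A) (not B)) :=
  beta₂_of (by simp)

theorem leibniz_inst (P : Tm K (α :: Γ) Ty.t) (A B : Tm K Γ α) :
    Thm Ax (imp (.eq A B) (.eq (P.inst A) (P.inst B))) :=
  eqMP (imp_congr (refl _) (congEq (beta P A) (beta P B))) (leibniz A B (.lam P))

theorem all_imp_inst (P : Tm K (α :: Γ) Ty.t) (A : Tm K Γ α) : Thm Ax (imp (all P) (P.inst A)) := by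
  have h := leibniz_inst (Ax := Ax) (.app b0 A.wk) (.lam tt) (.lam P)
  simp only [Tm.inst, Tm.subst, instSub_zero, Tm.subst_instSub_wk] at h
  exact eqMP (imp_congr (refl _) ((congEq (beta tt A) (beta P A)).trans (tt_eq _))) h

theorem ff_and (A : Tm K Γ Ty.t) : and ff A ≐[Ax] ff :=
  (eqMP (imp_def ff A) (all_imp_inst b0 A)).symm

theorem and_ff (A : Tm K Γ Ty.t) : and A ff ≐[Ax] ff :=
  eq_cases (M := and b0 ff) (N := ff) and_tt_ff (ff_and ff) A

theorem ff_eq_tt : .eq ff tt ≐[Ax] (ff : Tm K Γ Ty.t) := by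
  have ff_eq_tt_imp_ff : Thm Ax (imp (.eq ff tt) (ff : Tm K Γ Ty.t)) :=
    eqMP (imp_congr (refl _) ((congEq (tt_eq_refl ff).symm tt_eq_ff).trans (tt_eq ff)))
      (leibniz_inst (.eq b0 ff) ff tt)
  exact (eqMP (imp_def _ _) ff_eq_tt_imp_ff).trans (and_ff _)

end Thm

/-! ### Tautologies -/

/-- Propositional formulas with variables from `ι`. They serve to prove substitution instances of
tautologies by evaluation. -/
inductive PropForm (ι : Type*) : Type _
  | var : ι → PropForm ι
  | tt : PropForm ι
  | ff : PropForm ι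
  | eq : PropForm ι → PropForm ι → PropForm ι
  | and : PropForm ι → PropForm ι → PropForm ι
  | imp : PropForm ι → PropForm ι → PropForm ι
  | or : PropForm ι → PropForm ι → PropForm ι
  | not : PropForm ι → PropForm ι

section Tautologies

variable {ι : Type*}

namespace PropForm

/-- The truth value of a propositional formula under an assignment. -/
def eval (v : ι → Bool) : PropForm ι → Bool
  | var i => v i
  | tt => true
  | ff => false
  | eq φ ψ => φ.eval v == ψ.eval v
  | and φ ψ => φ.eval v && ψ.eval v
  | imp φ ψ => !φ.eval v || ψ.eval v
  | or φ ψ => φ.eval v || ψ.eval v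
  | not φ => !φ.eval v

/-- The formula of the type theory obtained by substituting formulas for the variables. -/
def interp (σ : ι → Tm K Γ Ty.t) : PropForm ι → Tm K Γ Ty.t
  | var i => σ i
  | tt => TyN.tt
  | ff => TyN.ff
  | eq φ ψ => .eq (φ.interp σ) (ψ.interp σ)
  | and φ ψ => TyN.and (φ.interp σ) (ψ.interp σ)
  | imp φ ψ => TyN.imp (φ.interp σ) (ψ.interp σ)
  | or φ ψ => TyN.or (φ.interp σ) (ψ.interp σ)
  | not φ => TyN.not (φ.interp σ)

theorem interp_subst (φ : PropForm ι) (σ : ι → Tm K Γ Ty.t) (τ : ∀ α, Idx Γ α → Tm K Θ α) :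
    (φ.interp σ).subst τ = φ.interp fun i => (σ i).subst τ := by
  induction φ <;>
    simp_all only [interp, Tm.subst, tt_subst, ff_subst, and_subst, imp_subst, or_subst, not_subst]

end PropForm

/-- The constant denoting a truth value. -/
def boolT : Bool → Tm K Γ Ty.t
  | true => tt
  | false => ff

namespace Thm

theorem eq_boolT : ∀ a b : Bool,
    .eq (boolT a) (boolT b) ≐[Ax] (boolT (a == b) : Tm K Γ Ty.t)
  | true, true | false, false => (tt_eq_refl _).symm
  | true, false => tt_eq_ff
  | false, true => ff_eq_tt

theorem and_boolT : ∀ a b : Bool,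
    and (boolT a) (boolT b) ≐[Ax] (boolT (a && b) : Tm K Γ Ty.t)
  | true, _ => tt_and _
  | false, _ => ff_and _

theorem not_boolT (a : Bool) : not (boolT a) ≐[Ax] (boolT (!a) : Tm K Γ Ty.t) := by
  cases a
  exacts [eq_boolT false false, eq_boolT false true]

theorem imp_boolT (a b : Bool) :
    imp (boolT a) (boolT b) ≐[Ax] (boolT (!a || b) : Tm K Γ Ty.t) :=
  calc imp (boolT a) (boolT b)
    _ ≐[Ax] .eq (boolT a) (and (boolT a) (boolT b)) := imp_def _ _
    _ ≐[Ax] .eq (boolT a) (boolT (a && b)) := congEq (refl _) (and_boolT a b)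
    _ ≐[Ax] boolT (a == (a && b)) := eq_boolT _ _
    _ ≐[Ax] boolT (!a || b) := by cases a <;> cases b <;> exact refl _

theorem or_boolT (a b : Bool) :
    or (boolT a) (boolT b) ≐[Ax] (boolT (a || b) : Tm K Γ Ty.t) :=
  calc or (boolT a) (boolT b)
    _ ≐[Ax] not (and (not (boolT a)) (not (boolT b))) := or_def _ _
    _ ≐[Ax] not (and (boolT !a) (boolT !b)) := not_congr (and_congr (not_boolT a) (not_boolT b))
    _ ≐[Ax] not (boolT (!a && !b)) := not_congr (and_boolT _ _)
    _ ≐[Ax] boolT !(!a && !b) := not_boolT _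
    _ ≐[Ax] boolT (a || b) := by cases a <;> cases b <;> exact refl _

theorem interp_boolT (φ : PropForm ι) (v : ι → Bool) :
    φ.interp (fun i => boolT (v i)) ≐[Ax] (boolT (φ.eval v) : Tm K Γ Ty.t) := by
  induction φ with
  | var | tt | ff => exact refl _
  | eq _ _ hφ hψ => exact (congEq hφ hψ).trans (eq_boolT _ _)
  | and _ _ hφ hψ => exact (and_congr hφ hψ).trans (and_boolT _ _)
  | imp _ _ hφ hψ => exact (imp_congr hφ hψ).trans (imp_boolT _ _)
  | or _ _ hφ hψ => exact (or_congr hφ hψ).trans (or_boolT _ _)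
  | not _ hφ => exact (not_congr hφ).trans (not_boolT _)

theorem taut_of_finset {φ : PropForm ι} (hφ : ∀ v, φ.eval v = true) (s : Finset ι)
    (σ : ι → Tm K Γ Ty.t) (hσ : ∀ i ∉ s, ∃ b, σ i = boolT b) : Thm Ax (φ.interp σ) := by
  classical
  induction s using Finset.induction_on generalizing σ with
  | empty =>
    choose v hv using fun i => hσ i (Finset.notMem_empty i)
    obtain rfl : σ = fun i => boolT (v i) := _root_.funext hv
    have h := interp_boolT (Ax := Ax) (Γ := Γ) φ v
    rw [hφ v] at h
    exact eqMPR h tt_intro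
  | insert j s _ ih =>
    let P : Tm K (Ty.t :: Γ) Ty.t := φ.interp (Function.update (fun i => (σ i).wk) j b0)
    have P_inst (B : Tm K Γ Ty.t) : P.inst B = φ.interp (Function.update σ j B) := by
      rw [Tm.inst, PropForm.interp_subst]
      congr 1
      funext i
      by_cases hi : i = j
      · subst hi; simp
      · simp [hi]
    have thm_P_inst (b : Bool) : Thm Ax (P.inst (boolT b)) := by
      rw [P_inst]
      refine ih _ fun i hi => ?_
      by_cases hij : i = j
      · subst hij; exact ⟨b, by simp⟩
      · simpa [hij] using hσ i (by simp [hi, hij])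
    have h := bool_cases (thm_P_inst true) (thm_P_inst false) (σ j)
    rwa [P_inst, Function.update_eq_self] at h

theorem taut [Finite ι] (φ : PropForm ι) (hφ : ∀ v, φ.eval v = true) (σ : ι → Tm K Γ Ty.t) :
    Thm Ax (φ.interp σ) :=
  have := Fintype.ofFinite ι
  taut_of_finset hφ Finset.univ σ fun i hi => absurd (Finset.mem_univ i) hi

end Thm

end Tautologies

namespace Thm

section Propositional

variable {A B C : Tm K Γ Ty.t}

theorem mp (h : Thm Ax (imp A B)) (hA : Thm Ax A) : Thm Ax B :=
  have tt_imp_B : Thm Ax (imp tt B) := eqMP (imp_congr (eq_tt hA) (refl B)) h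
  eqMP (taut (.eq (.imp .tt (.var 0)) (.var 0)) (by decide) ![B]) tt_imp_B

theorem imp_of_eq (h : A ≐[Ax] B) : Thm Ax (imp A B) :=
  (taut (.imp (.eq (.var 0) (.var 1)) (.imp (.var 0) (.var 1))) (by decide) ![A, B]).mp h

theorem imp_refl (A : Tm K Γ Ty.t) : Thm Ax (imp A A) := imp_of_eq (refl A)

theorem imp_of_thm (h : Thm Ax B) : Thm Ax (imp A B) :=
  (taut (.imp (.var 1) (.imp (.var 0) (.var 1))) (by decide) ![A, B]).mp h

theorem eq_of_imp (h : Thm Ax (imp A B)) (h' : Thm Ax (imp B A)) : A ≐[Ax] B :=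
  ((taut (.imp (.imp (.var 0) (.var 1)) (.imp (.imp (.var 1) (.var 0)) (.eq (.var 0) (.var 1))))
    (by decide) ![A, B]).mp h).mp h'

theorem imp_trans (h : Thm Ax (imp A B)) (h' : Thm Ax (imp B C)) : Thm Ax (imp A C) :=
  ((taut (.imp (.imp (.var 0) (.var 1)) (.imp (.imp (.var 1) (.var 2)) (.imp (.var 0) (.var 2))))
    (by decide) ![A, B, C]).mp h).mp h'

theorem imp_and (h : Thm Ax (imp A B)) (h' : Thm Ax (imp A C)) : Thm Ax (imp A (and B C)) :=
  ((taut (.imp (.imp (.var 0) (.var 1)) (.imp (.imp (.var 0) (.var 2))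
    (.imp (.var 0) (.and (.var 1) (.var 2))))) (by decide) ![A, B, C]).mp h).mp h'

theorem or_imp (h : Thm Ax (imp A C)) (h' : Thm Ax (imp B C)) : Thm Ax (imp (or A B) C) :=
  ((taut (.imp (.imp (.var 0) (.var 2)) (.imp (.imp (.var 1) (.var 2))
    (.imp (.or (.var 0) (.var 1)) (.var 2)))) (by decide) ![A, B, C]).mp h).mp h'

theorem contrapose (h : Thm Ax (imp A B)) : Thm Ax (imp (not B) (not A)) :=
  (taut (.imp (.imp (.var 0) (.var 1)) (.imp (.not (.var 1)) (.not (.var 0))))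
    (by decide) ![A, B]).mp h

variable (A B)

theorem and_imp_left : Thm Ax (imp (and A B) A) :=
  taut (.imp (.and (.var 0) (.var 1)) (.var 0)) (by decide) ![A, B]

theorem and_imp_right : Thm Ax (imp (and A B) B) :=
  taut (.imp (.and (.var 0) (.var 1)) (.var 1)) (by decide) ![A, B]

theorem imp_or_left : Thm Ax (imp A (or A B)) :=
  taut (.imp (.var 0) (.or (.var 0) (.var 1))) (by decide) ![A, B]

theorem imp_or_right : Thm Ax (imp B (or A B)) :=
  taut (.imp (.var 1) (.or (.var 0) (.var 1))) (by decide) ![A, B]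

theorem not_not_eq : not (not A) ≐[Ax] A :=
  taut (.eq (.not (.not (.var 0))) (.var 0)) (by decide) ![A]

end Propositional

/-! ### Quantifiers and equality -/

theorem all_imp_distrib (Q : Tm K Γ Ty.t) (P : Tm K (α :: Γ) Ty.t) :
    Thm Ax (imp (all (imp Q.wk P)) (imp Q (all P))) := by
  have h := bool_cases (Ax := Ax) (P := imp (all (imp b1 P.wkUnder)) (imp b0 (all P.wkUnder)))
    (A := Q)
  simp only [Tm.inst, imp_subst, all_subst, Tm.subst, liftSub_succ, instSub_zero, tt_wk, ff_wk,
    Tm.wkUnder_subst_liftSub_instSub] at h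
  apply h
  · have tt_imp_eq : imp tt P ≐[Ax] P :=
      taut (.eq (.imp .tt (.var 0)) (.var 0)) (by decide) ![P]
    exact imp_trans (imp_of_eq (all_congr tt_imp_eq))
      (taut (.imp (.var 0) (.imp .tt (.var 0))) (by decide) ![all P])
  · exact taut (.imp (.var 0) (.imp .ff (.var 1))) (by decide) ![all (imp ff P), all P]

theorem imp_all {Q : Tm K Γ Ty.t} {P : Tm K (α :: Γ) Ty.t} (h : Thm Ax (imp Q.wk P)) :
    Thm Ax (imp Q (all P)) :=
  (all_imp_distrib Q P).mp (all_intro h)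

theorem inst_imp_ex (P : Tm K (α :: Γ) Ty.t) (A : Tm K Γ α) : Thm Ax (imp (P.inst A) (ex P)) :=
  imp_trans (imp_of_eq (not_not_eq _).symm) (contrapose (all_imp_inst (not P) A))

theorem imp_ex_wk (P : Tm K (α :: Γ) Ty.t) : Thm Ax (imp P (ex P).wk) := by
  have h := inst_imp_ex (Ax := Ax) P.wkUnder b0
  rwa [Tm.inst, Tm.wkUnder_subst_instSub_b0] at h

theorem ex_imp {Q : Tm K Γ Ty.t} {P : Tm K (α :: Γ) Ty.t} (h : Thm Ax (imp P Q.wk)) :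
    Thm Ax (imp (ex P) Q) :=
  imp_trans (contrapose (imp_all (Q := not Q) (contrapose h))) (imp_of_eq (not_not_eq Q))

theorem ex_imp_ex {P Q : Tm K (α :: Γ) Ty.t} (h : Thm Ax (imp P Q)) :
    Thm Ax (imp (ex P) (ex Q)) :=
  ex_imp (imp_trans h (imp_ex_wk Q))

theorem ex_or (P Q : Tm K (α :: Γ) Ty.t) : ex (or P Q) ≐[Ax] or (ex P) (ex Q) :=
  eq_of_imp
    (ex_imp (or_imp (imp_trans (imp_ex_wk P) (imp_or_left _ _))
      (imp_trans (imp_ex_wk Q) (imp_or_right _ _))))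
    (or_imp (ex_imp_ex (imp_or_left P Q)) (ex_imp_ex (imp_or_right P Q)))

theorem ex_ff : ex (ff : Tm K (α :: Γ) Ty.t) ≐[Ax] ff :=
  eq_of_imp (ex_imp (imp_refl ff)) (taut (.imp .ff (.var 0)) (by decide) ![ex ff])

theorem eq_and_imp (P : Tm K (α :: Γ) Ty.t) (A B : Tm K Γ α) :
    Thm Ax (imp (and (.eq A B) (P.inst A)) (P.inst B)) :=
  (taut (.imp (.imp (.var 0) (.eq (.var 1) (.var 2))) (.imp (.and (.var 0) (.var 1)) (.var 2)))
    (by decide) ![.eq A B, P.inst A, P.inst B]).mp (leibniz_inst P A B)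

theorem eq_imp_congr (M : Tm K (α :: Γ) β) (A B : Tm K Γ α) :
    Thm Ax (imp (.eq A B) (.eq (M.inst A) (M.inst B))) := by
  have h := eq_and_imp (Ax := Ax) (.eq (M.inst A).wk M) A B
  simp only [Tm.inst, Tm.subst, Tm.subst_instSub_wk] at h
  exact imp_trans (imp_and (imp_refl _) (imp_of_thm (refl _))) h

theorem eq_trans_imp (A B C : Tm K Γ α) : Thm Ax (imp (and (.eq A B) (.eq B C)) (.eq A C)) := by
  have h := eq_and_imp (Ax := Ax) (.eq A.wk b0) B C
  simp only [Tm.inst, Tm.subst, Tm.subst_instSub_wk, instSub_zero] at h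
  exact imp_trans (imp_and (and_imp_right _ _) (and_imp_left _ _)) h

theorem ex_eq_and (A : Tm K Γ α) (P : Tm K (α :: Γ) Ty.t) :
    ex (and (.eq b0 A.wk) P) ≐[Ax] P.inst A := by
  apply eq_of_imp
  · apply ex_imp
    have h := eq_and_imp (Ax := Ax) P.wkUnder b0 A.wk
    rwa [← Tm.wk_inst, Tm.inst, Tm.wkUnder_subst_instSub_b0] at h
  · have h := inst_imp_ex (Ax := Ax) (and (.eq b0 A.wk) P) A
    simp only [Tm.inst, and_subst, Tm.subst, instSub_zero, Tm.subst_instSub_wk] at h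
    exact imp_trans (imp_and (imp_of_thm (refl A)) (imp_refl _)) h

theorem eta (f : Tm K Γ (α ⇒ₜ β)) : .lam (.app f.wk b0) ≐[Ax] f :=
  eqMPR (funext _ _) (all_intro (beta_of (by simp)))

end Thm

/-! ### Families of pairs -/

section Families

/-- The family `λ x π₁ (X x)` of first components of a family of pairs. -/
def fstFam (X : Tm K Γ (γ ⇒ₜ α ×ₜ β)) : Tm K Γ (γ ⇒ₜ α) := .lam (.fst (.app X.wk b0))

/-- The family `λ x π₂ (X x)` of second components of a family of pairs. -/
def sndFam (X : Tm K Γ (γ ⇒ₜ α ×ₜ β)) : Tm K Γ (γ ⇒ₜ β) := .lam (.snd (.app X.wk b0))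

/-- The family `λ x (U x, V x)` of pairs with given components: the object of type `γ(α × β)`
identified with the pair of the objects `U` and `V`. -/
def pairFam (U : Tm K Γ (γ ⇒ₜ α)) (V : Tm K Γ (γ ⇒ₜ β)) : Tm K Γ (γ ⇒ₜ α ×ₜ β) :=
  .lam (.pair (.app U.wk b0) (.app V.wk b0))

variable (σ : ∀ α, Idx Γ α → Tm K Θ α) (X : Tm K Γ (γ ⇒ₜ α ×ₜ β)) (U : Tm K Γ (γ ⇒ₜ α))
  (V : Tm K Γ (γ ⇒ₜ β))

@[simp] theorem fstFam_subst : (fstFam X).subst σ = fstFam (X.subst σ) := by simp [fstFam]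

@[simp] theorem sndFam_subst : (sndFam X).subst σ = sndFam (X.subst σ) := by simp [sndFam]

@[simp] theorem pairFam_subst :
    (pairFam U V).subst σ = pairFam (U.subst σ) (V.subst σ) := by
  simp [pairFam]

@[simp] theorem fstFam_wk : (fstFam X).wk (β := δ) = fstFam X.wk := by simp [fstFam]

@[simp] theorem sndFam_wk : (sndFam X).wk (β := δ) = sndFam X.wk := by simp [sndFam]

@[simp] theorem pairFam_wk : (pairFam U V).wk (β := δ) = pairFam U.wk V.wk := by simp [pairFam]

namespace Thm

theorem fstFam_app (A : Tm K Γ γ) : .app (fstFam X) A ≐[Ax] .fst (.app X A) :=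
  beta_of (by simp)

theorem sndFam_app (A : Tm K Γ γ) : .app (sndFam X) A ≐[Ax] .snd (.app X A) :=
  beta_of (by simp)

theorem pairFam_app (A : Tm K Γ γ) :
    .app (pairFam U V) A ≐[Ax] .pair (.app U A) (.app V A) :=
  beta_of (by simp)

theorem fstFam_pairFam : fstFam (pairFam U V) ≐[Ax] U := by
  rw [fstFam, pairFam_wk]
  exact (congLam ((congFst (pairFam_app _ _ _)).trans (fst_pair _ _))).trans (eta U)

theorem sndFam_pairFam : sndFam (pairFam U V) ≐[Ax] V := by
  rw [sndFam, pairFam_wk]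
  exact (congLam ((congSnd (pairFam_app _ _ _)).trans (snd_pair _ _))).trans (eta V)

theorem pairFam_fstFam_sndFam : pairFam (fstFam X) (sndFam X) ≐[Ax] X := by
  rw [pairFam, fstFam_wk, sndFam_wk]
  exact (congLam ((congPair (fstFam_app _ _) (sndFam_app _ _)).trans (pair_eta _))).trans (eta X)

theorem pairFam_congr_imp (U' : Tm K Γ (γ ⇒ₜ α)) (V' : Tm K Γ (γ ⇒ₜ β)) :
    Thm Ax (imp (and (.eq U U') (.eq V V')) (.eq (pairFam U V) (pairFam U' V'))) := by
  have hU := eq_imp_congr (Ax := Ax) (pairFam b0 V.wk) U U'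
  have hV := eq_imp_congr (Ax := Ax) (pairFam U'.wk b0) V V'
  simp only [Tm.inst, pairFam_subst, Tm.subst, instSub_zero, Tm.subst_instSub_wk] at hU hV
  exact imp_trans (imp_and (imp_trans (and_imp_left _ _) hU) (imp_trans (and_imp_right _ _) hV))
    (eq_trans_imp _ _ _)

theorem components_eq_iff :
    and (.eq (fstFam X) U) (.eq (sndFam X) V) ≐[Ax] .eq X (pairFam U V) := by
  apply eq_of_imp
  · exact imp_trans (pairFam_congr_imp _ _ _ _)
      (imp_of_eq (congEq (pairFam_fstFam_sndFam X) (refl _)))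
  · have hU := eq_imp_congr (Ax := Ax) (fstFam b0) X (pairFam U V)
    have hV := eq_imp_congr (Ax := Ax) (sndFam b0) X (pairFam U V)
    simp only [Tm.inst, fstFam_subst, sndFam_subst, Tm.subst, instSub_zero] at hU hV
    exact imp_and (imp_trans hU (imp_of_eq (congEq (refl _) (fstFam_pairFam U V))))
      (imp_trans hV (imp_of_eq (congEq (refl _) (sndFam_pairFam U V))))

end Thm

end Families

/-! ### Images of predicates -/

section Images

/-- The image `λ y ∃ x (M x ∧ y = G x)` of the predicate `M` under the function `G`. -/
def image (M : Tm K Γ (α ⇒ₜ Ty.t)) (G : Tm K Γ (α ⇒ₜ β)) : Tm K Γ (β ⇒ₜ Ty.t) :=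
  .lam (ex (and (.app M.wk.wk b0) (.eq b1 (.app G.wk.wk b0))))

@[simp] theorem image_subst (σ : ∀ α, Idx Γ α → Tm K Θ α) (M : Tm K Γ (α ⇒ₜ Ty.t))
    (G : Tm K Γ (α ⇒ₜ β)) : (image M G).subst σ = image (M.subst σ) (G.subst σ) := by
  simp [image]

@[simp] theorem image_wk (M : Tm K Γ (α ⇒ₜ Ty.t)) (G : Tm K Γ (α ⇒ₜ β)) :
    (image M G).wk (β := δ) = image M.wk G.wk := by
  simp [image]

namespace Thm

theorem eqTo_app (A B : Tm K Γ α) : .app (eqTo A) B ≐[Ax] .eq B A := beta_of (by simp)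

theorem orPred_app (P Q : Tm K Γ (α ⇒ₜ Ty.t)) (A : Tm K Γ α) :
    .app (orPred P Q) A ≐[Ax] or (.app P A) (.app Q A) :=
  beta_of (by simp)

theorem prodPred_app (P : Tm K Γ (α ⇒ₜ Ty.t)) (Q : Tm K Γ (β ⇒ₜ Ty.t)) (A : Tm K Γ α)
    (B : Tm K Γ β) : .app (.app (prodPred P Q) A) B ≐[Ax] and (.app P A) (.app Q B) :=
  beta₂_of (by simp)

theorem image_app (M : Tm K Γ (α ⇒ₜ Ty.t)) (G : Tm K Γ (α ⇒ₜ β)) (X : Tm K Γ β) :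
    .app (image M G) X ≐[Ax] ex (and (.app M.wk b0) (.eq X.wk (.app G.wk b0))) :=
  beta_of (by simp)

theorem orPred_congr {P P' Q Q' : Tm K Γ (α ⇒ₜ Ty.t)} (hP : P ≐[Ax] P') (hQ : Q ≐[Ax] Q') :
    orPred P Q ≐[Ax] orPred P' Q' := by
  have hP := inst_congr (orPred b0 Q.wk) hP
  have hQ := inst_congr (orPred P'.wk b0) hQ
  simp only [Tm.inst, orPred_subst, Tm.subst, instSub_zero, Tm.subst_instSub_wk] at hP hQ
  exact hP.trans hQ

theorem image_congr_imp (M M' : Tm K Γ (α ⇒ₜ Ty.t)) (G : Tm K Γ (α ⇒ₜ β)) :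
    Thm Ax (imp (.eq M M') (.eq (image M G) (image M' G))) := by
  simpa using eq_imp_congr (Ax := Ax) (image b0 G.wk) M M'

theorem image_eqTo (G : Tm K Γ (α ⇒ₜ β)) (A : Tm K Γ α) :
    image (eqTo A) G ≐[Ax] eqTo (.app G A) := by
  simp only [image, eqTo_wk]
  refine congLam ?_
  calc ex (and (.app (eqTo A.wk.wk) b0) (.eq b1 (.app G.wk.wk b0)))
    _ ≐[Ax] ex (and (.eq b0 A.wk.wk) (.eq b1 (.app G.wk.wk b0))) :=
      ex_congr (and_congr (eqTo_app _ _) (refl _))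
    _ ≐[Ax] (Tm.eq b1 (.app G.wk.wk b0)).inst A.wk := ex_eq_and _ _
    _ ≐[Ax] .eq b0 (Tm.app G A).wk := by simpa using refl _

theorem image_lam_ff (G : Tm K Γ (α ⇒ₜ β)) : image (.lam ff) G ≐[Ax] .lam ff :=
  have no_argument : and (.app (.lam ff) b0) (.eq b1 (.app G.wk.wk b0)) ≐[Ax] ff :=
    (and_congr (beta ff b0) (refl _)).trans (ff_and _)
  congLam ((ex_congr no_argument).trans ex_ff)

theorem image_orPred (P Q : Tm K Γ (α ⇒ₜ Ty.t)) (G : Tm K Γ (α ⇒ₜ β)) :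
    image (orPred P Q) G ≐[Ax] orPred (image P G) (image Q G) := by
  have and_distrib (A B C : Tm K (α :: β :: Γ) Ty.t) :
      and (or A B) C ≐[Ax] or (and A C) (and B C) :=
    taut (.eq (.and (.or (.var 0) (.var 1)) (.var 2))
      (.or (.and (.var 0) (.var 2)) (.and (.var 1) (.var 2)))) (by decide) ![A, B, C]
  rw [image, orPred_wk, orPred_wk]
  refine congLam (A' := or (.app (image P G).wk b0) (.app (image Q G).wk b0)) ?_
  rw [image_wk, image_wk]
  refine .trans ?_ (or_congr (image_app P.wk G.wk b0) (image_app Q.wk G.wk b0)).symm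
  refine .trans (ex_congr ?_) (ex_or _ _)
  exact (and_congr (orPred_app _ _ _) (refl _)).trans (and_distrib _ _ _)

theorem image_bigOrEq (G : Tm K Γ (α ⇒ₜ β)) :
    ∀ l : List (Tm K Γ α), image (bigOrEq l) G ≐[Ax] bigOrEq (l.map (.app G))
  | [] => image_lam_ff G
  | A :: l => (image_orPred _ _ _).trans (orPred_congr (image_eqTo G A) (image_bigOrEq G l))

theorem imp_image (M : Tm K Γ (α ⇒ₜ Ty.t)) (G : Tm K Γ (α ⇒ₜ β)) (A : Tm K Γ α) (X : Tm K Γ β) :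
    Thm Ax (imp (and (.app M A) (.eq X (.app G A))) (.app (image M G) X)) := by
  have h := inst_imp_ex (Ax := Ax) (and (.app M.wk b0) (.eq X.wk (.app G.wk b0))) A
  simp only [Tm.inst, and_subst, Tm.subst, Tm.subst_instSub_wk, instSub_zero] at h
  exact imp_trans h (imp_of_eq (image_app M G X).symm)

theorem image_imp {G : Tm K Γ (α ⇒ₜ β)} {H : Tm K Γ (β ⇒ₜ α)}
    (hGH : .app H.wk (.app G.wk b0) ≐[Ax] b0) (M : Tm K Γ (α ⇒ₜ Ty.t)) (X : Tm K Γ β) :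
    Thm Ax (imp (.app (image M G) X)
      (and (.app M (.app H X)) (.eq X (.app G (.app H X))))) := by
  let P : Tm K (β :: α :: Γ) Ty.t := and (.app M.wk.wk (.app H.wk.wk b0))
    (.eq b0 (.app G.wk.wk (.app H.wk.wk b0)))
  have P_inst (Y : Tm K (α :: Γ) β) : P.inst Y =
      and (.app M.wk (.app H.wk Y)) (.eq Y (.app G.wk (.app H.wk Y))) := by
    simp [P]
  have imp_P_inst : Thm Ax (imp (.app M.wk b0) (P.inst (.app G.wk b0))) := by
    rw [P_inst]
    exact imp_trans (imp_and (imp_refl _) (imp_of_thm (refl _))) (imp_of_eq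
      (and_congr (congApp (refl _) hGH.symm) (congEq (refl _) (congApp (refl _) hGH.symm))))
  have imp_P_inst_wk :
      Thm Ax (imp (and (.app M.wk b0) (.eq X.wk (.app G.wk b0))) (P.inst X.wk)) :=
    ((taut (.imp (.imp (.var 0) (.var 1)) (.imp (.imp (.var 2) (.eq (.var 3) (.var 1)))
      (.imp (.and (.var 0) (.var 2)) (.var 3)))) (by decide)
      ![.app M.wk b0, P.inst (.app G.wk b0), .eq X.wk (.app G.wk b0), P.inst X.wk]).mp
        imp_P_inst).mp (leibniz_inst P _ _)
  rw [P_inst] at imp_P_inst_wk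
  exact imp_trans (imp_of_eq (image_app M G X)) (ex_imp imp_P_inst_wk)

end Thm

end Images

/-! ### Raising of objects -/

section Raising

/-- The function `⟨F⟩ = λ x_α λ x_γ (F x_α x_γ, x_α)` raising an object to the family of pairs with
components `F x_α` and `λ x_γ x_α`. -/
def raisingT (F : Tm K Γ (α ⇒ₜ γ ⇒ₜ δ)) : Tm K Γ (α ⇒ₜ γ ⇒ₜ δ ×ₜ α) :=
  .lam (pairFam (.app F.wk b0) (.lam b1))

/-- A left inverse `λ z π₂ (z x_γ)` of raising, where `x_γ` is a free variable. -/
def lowerT : Tm K Γ ((γ ⇒ₜ δ ×ₜ α) ⇒ₜ α) := .lam (.snd (.app b0 (.fvar 0)))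

@[simp] theorem raisingT_wk (F : Tm K Γ (α ⇒ₜ γ ⇒ₜ δ)) :
    (raisingT F).wk (β := β) = raisingT F.wk := by
  simp [raisingT, pairFam]

namespace Thm

variable (F : Tm K Γ (α ⇒ₜ γ ⇒ₜ δ))

theorem raisingT_app (A : Tm K Γ α) :
    .app (raisingT F) A ≐[Ax] pairFam (.app F A) (.lam A.wk) :=
  beta_of (by simp)

theorem components_eq_raisingT_iff (X : Tm K Γ (γ ⇒ₜ δ ×ₜ α)) (A : Tm K Γ α) :
    and (.eq (fstFam X) (.app F A)) (.eq (sndFam X) (.lam A.wk)) ≐[Ax]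
      .eq X (.app (raisingT F) A) :=
  (components_eq_iff _ _ _).trans (congEq (refl X) (raisingT_app F A).symm)

theorem lowerT_raisingT (A : Tm K Γ α) : .app lowerT (.app (raisingT F) A) ≐[Ax] A :=
  calc .app lowerT (.app (raisingT F) A)
    _ ≐[Ax] .snd (.app (.app (raisingT F) A) (.fvar 0)) := beta _ _
    _ ≐[Ax] .snd (.app (pairFam (.app F A) (.lam A.wk)) (.fvar 0)) :=
      congSnd (congApp (raisingT_app F A) (refl _))
    _ ≐[Ax] .snd (.pair (.app (.app F A) (.fvar 0)) (.app (.lam A.wk) (.fvar 0))) :=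
      congSnd (pairFam_app _ _ _)
    _ ≐[Ax] .app (.lam A.wk) (.fvar 0) := snd_pair _ _
    _ ≐[Ax] A := beta_of (by simp)

theorem image_raisingT_imp (M : Tm K Γ (α ⇒ₜ Ty.t)) (X : Tm K Γ (γ ⇒ₜ δ ×ₜ α)) :
    Thm Ax (imp (.app (image M (raisingT F)) X)
      (and (.app M (.app lowerT X)) (.eq X (.app (raisingT F) (.app lowerT X))))) :=
  image_imp (H := lowerT) (by rw [raisingT_wk]; exact lowerT_raisingT _ _) M X

end Thm

end Raising

/-! ### Derivability from hypotheses -/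

namespace Derives

variable {Δ : Set (Tm K [] Ty.t)} {A B : Tm K [] Ty.t}

theorem mp_thm (h : Thm Ax (imp A B)) (hA : Derives Ax Δ A) : Derives Ax Δ B := mp (thm h) hA

theorem congr (h : A ≐[Ax] B) : Derives Ax Δ A ↔ Derives Ax Δ B :=
  ⟨mp_thm (.imp_of_eq h), mp_thm (.imp_of_eq h.symm)⟩

theorem and_intro (hA : Derives Ax Δ A) (hB : Derives Ax Δ B) : Derives Ax Δ (and A B) :=
  mp (mp_thm (.taut (.imp (.var 0) (.imp (.var 1) (.and (.var 0) (.var 1)))) (by decide) ![A, B])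
    hA) hB

end Derives

end Logic

/-! ### Context raising -/

section Symbolic

variable {n : ℕ} [Fact (2 < n)] {N : ℕ} {S : Ty n → Type u} {E : Ty n → Type v}
  {Ax : Set (STm N S Ty.t)} {Γ Θ : List (Ty n)} {α : Ty n}

@[simp] theorem uncur_subst (σ : ∀ α, Idx Γ α → Tm (SymConst N S) Θ α)
    (R : Tm (SymConst N S) Γ ((cTy ⇒ₜ cTy) ⇒ₜ (cTy ⇒ₜ α) ⇒ₜ Ty.t)) :
    (uncur R).subst σ = uncur (R.subst σ) := by
  simp [uncur]

namespace Thm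

theorem uncur_app (R : Tm (SymConst N S) Γ ((cTy ⇒ₜ cTy) ⇒ₜ (cTy ⇒ₜ α) ⇒ₜ Ty.t))
    (X : Tm (SymConst N S) Γ (ctxTy α)) :
    .app (uncur R) X ≐[Ax] .app (.app R (fstFam X)) (sndFam X) :=
  beta_of (by simp [fstFam, sndFam])

theorem raiseRuleT_app (F : STm N S (α ⇒ₜ cTy ⇒ₜ cTy)) (A : STm N S α) (B : STm N S (ctxTy α)) :
    .app (.app (raiseRuleT F) A) B ≐[Ax] .eq B (.app (raisingT F) A) :=
  calc .app (.app (raiseRuleT F) A) B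
    _ ≐[Ax] .app (uncur (prodPred (eqTo (.app F A)) (eqTo (.lam A.wk)))) B :=
      congApp (beta_of (by simp)) (refl B)
    _ ≐[Ax] .app (.app (prodPred (eqTo (.app F A)) (eqTo (.lam A.wk))) (fstFam B)) (sndFam B) :=
      uncur_app _ B
    _ ≐[Ax] and (.eq (fstFam B) (.app F A)) (.eq (sndFam B) (.lam A.wk)) :=
      (prodPred_app _ _ _ _).trans (and_congr (eqTo_app _ _) (eqTo_app _ _))
    _ ≐[Ax] .eq B (.app (raisingT F) A) := components_eq_raisingT_iff F B A

theorem upT_app (L : STm N S (sTy ⇒ₜ α ⇒ₜ Ty.t)) (F : STm N S (α ⇒ₜ cTy ⇒ₜ cTy))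
    (W : STm N S sTy) :
    .app (.app (.app upT L) F) W ≐[Ax] image (.app L W) (raisingT F) := by
  let R : STm N S ((cTy ⇒ₜ cTy) ⇒ₜ (cTy ⇒ₜ α) ⇒ₜ Ty.t) :=
    .lam (.lam (ex (and (.app (Tm.app L W).wk.wk.wk b0)
      (and (.eq b2 (.app F.wk.wk.wk b0)) (.eq b1 (.lam b1))))))
  have upT_beta : .app (.app (.app upT L) F) W ≐[Ax] uncur R :=
    (congApp (beta₂_of rfl) (refl W)).trans (beta_of (by simp [R]))
  refine upT_beta.trans (congLam ?_)
  calc .app (.app R.wk (fstFam b0)) (sndFam b0)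
    _ ≐[Ax] ex (and (.app (Tm.app L W).wk.wk b0)
        (and (.eq (fstFam b1) (.app F.wk.wk b0)) (.eq (sndFam b1) (.lam b1)))) :=
      beta₂_of (by simp)
    _ ≐[Ax] ex (and (.app (Tm.app L W).wk.wk b0) (.eq b1 (.app (raisingT F).wk.wk b0))) := by
      rw [raisingT_wk, raisingT_wk]
      exact ex_congr (and_congr (refl _) (components_eq_raisingT_iff _ b1 b0))

end Thm

theorem incl_raisingT (F : STm N S (α ⇒ₜ cTy ⇒ₜ cTy)) :
    incl E (raisingT F) = raisingT (incl E F) := by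
  simp [incl, raisingT, pairFam, Tm.mapConst, Tm.mapConst_wk]

theorem mem_raise {ℒ : ALang N S α} {F : STm N S (α ⇒ₜ cTy ⇒ₜ cTy)} {w : List (Fin N)}
    {B : STm N S (ctxTy α)} :
    (w, B) ∈ raise ℒ F ↔ ∃ A, (w, A) ∈ ℒ ∧ SProv (.eq B (.app (raisingT F) A)) := by
  have ruleOf_iff (A : STm N S α) : (A, B) ∈ ruleOf (raiseRuleT F) ↔
      SProv (.eq B (.app (raisingT F) A)) :=
    ⟨.eqMP (.raiseRuleT_app F A B), .eqMPR (.raiseRuleT_app F A B)⟩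
  exact exists_congr fun A => and_congr_right' (ruleOf_iff A)

theorem Represents.raise {Δ : Set (STm N (fun β => S β ⊕ E β) Ty.t)}
    {L : STm N (fun β => S β ⊕ E β) (sTy ⇒ₜ α ⇒ₜ Ty.t)} {ℒ : ALang N S α}
    (h : Represents E Δ L ℒ) (conservative : ∀ A : STm N S Ty.t, SProv A ↔ SDerives Δ (incl E A))
    (F : STm N S (α ⇒ₜ cTy ⇒ₜ cTy)) :
    Represents E Δ (.app (.app upT L) (incl E F)) (raise ℒ F) where
  consistent := h.consistent
  mem_iff w B := by
    have mem_iff (A : STm N S α) : ((w, A) ∈ ℒ ∧ SProv (.eq B (.app (raisingT F) A))) ↔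
        SDerives Δ (.app (.app L (wordT w)) (incl E A)) ∧
        SDerives Δ (.eq (incl E B) (.app (raisingT (incl E F)) (incl E A))) := by
      rw [h.mem_iff, conservative, ← incl_raisingT]
      rfl
    have upT_iff : SDerives Δ (.app (.app (.app (.app upT L) (incl E F)) (wordT w)) (incl E B)) ↔
        SDerives Δ (.app (image (.app L (wordT w)) (raisingT (incl E F))) (incl E B)) :=
      Derives.congr (.congApp (.upT_app L (incl E F) (wordT w)) (.refl _))
    rw [mem_raise, upT_iff]
    constructor
    · rintro ⟨A, hA⟩
      obtain ⟨hwA, hAB⟩ := (mem_iff A).1 hA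
      exact .mp_thm (.imp_image _ _ _ _) (.and_intro hwA hAB)
    · intro hB
      have hB_lower := hB.mp_thm (.image_raisingT_imp _ _ _)
      exact ⟨.app lowerT B, (mem_iff _).2
        ⟨.mp_thm (.and_imp_left _ _) hB_lower, .mp_thm (.and_imp_right _ _) hB_lower⟩⟩

end Symbolic

end TyN

theorem proposition9p4 {n : ℕ} [Fact (2 < n)] {N : ℕ} {S : TyN.Ty n → Type u}
    {E : TyN.Ty n → Type v} {α : TyN.Ty n} (ℒ : TyN.ALang N S α)
    (Δ : Set (TyN.STm N (fun β => S β ⊕ E β) TyN.Ty.t))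
    (L : TyN.STm N (fun β => S β ⊕ E β) (TyN.Ty.fn TyN.sTy (TyN.Ty.fn α TyN.Ty.t)))
    (hL : TyN.PseudoCanonic E Δ L ℒ)
    (F : TyN.STm N S (TyN.Ty.fn α (TyN.Ty.fn TyN.cTy TyN.cTy))) :
    TyN.PseudoCanonic E Δ (TyN.Tm.app (TyN.Tm.app TyN.upT L) (TyN.incl E F))
      (TyN.raise ℒ F) := by
  refine ⟨hL.toRepresents.raise hL.conservative F, fun w => ?_, hL.conservative⟩
  obtain ⟨l, hl⟩ := hL.finite_meanings w
  refine ⟨l.map (.app (TyN.raisingT F)), ?_⟩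
  have incl_map : (l.map (.app (TyN.raisingT F))).map (TyN.incl E) =
      (l.map (TyN.incl E)).map (.app (TyN.raisingT (TyN.incl E F))) := by
    rw [← TyN.incl_raisingT, List.map_map, List.map_map]
    rfl
  rw [incl_map]
  have image_eq := TyN.Derives.mp_thm (.image_congr_imp _ _ (TyN.raisingT (TyN.incl E F))) hl
  exact (TyN.Derives.congr (.congEq (.upT_app L (TyN.incl E F) (TyN.wordT w))
    (.symm (.image_bigOrEq _ _)))).2 image_eq
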